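/- Let $d\ge 0$ be an integer. For a Lebesgue measurable set $A\subset\mathbb{R}^d$ let $|A|\in[0,\infty]$ be its Lebesgue measure and let $$\operatorname{Per}(A)=\sup\Big\{\int_A \operatorname{div}\varphi\,dx \ :\ \varphi\in C^1_c(\mathbb{R}^d;\mathbb{R}^d),\ |\varphi(x)|\le 1 \text{ for all } x\in\mathbb{R}^d\Big\}\in[0,\infty]$$ be its perimeter in the sense of De Giorgi. Then for every set $E\subset\mathbb{R}^d$ and every $r>0$, the open $r$-neighbourhood $E_r=\{x\in\mathbb{R}^d : \operatorname{dist}(x,E)<r\}$ (where $\operatorname{dist}$ is the Euclidean distance, and $\operatorname{dist}(x,\emptyset)=+\infty$) satisfies $$\operatorname{Per}(E_r)\le \frac{d}{r}\,|E_r|.$$ -/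

import Mathlib

open MeasureTheory
open scoped ENNReal

/-- The divergence `∑ i, ∂ᵢ φᵢ` of a vector field on `ℝᵈ`. -/
noncomputable def vectorFieldDiv {d : ℕ}
    (φ : EuclideanSpace ℝ (Fin d) → EuclideanSpace ℝ (Fin d))
    (x : EuclideanSpace ℝ (Fin d)) : ℝ :=
  ∑ i : Fin d, (fderiv ℝ φ x (EuclideanSpace.single i 1)) i

/-- The test fields in De Giorgi's definition of perimeter: `C¹` vector fields on `ℝᵈ` with
compact support whose Euclidean norm is at most `1` everywhere. -/
def IsPerimeterTestField {d : ℕ}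
    (φ : EuclideanSpace ℝ (Fin d) → EuclideanSpace ℝ (Fin d)) : Prop :=
  ContDiff ℝ 1 φ ∧ HasCompactSupport φ ∧ ∀ x, ‖φ x‖ ≤ 1

/-- The perimeter in `ℝᵈ`, in the sense of De Giorgi, of a (Lebesgue measurable) set `A`:
`sup {∫_A div φ : φ ∈ C¹_c(ℝᵈ; ℝᵈ), |φ| ≤ 1} ∈ [0, ∞]`. Since `φ = 0` is admissible the
supremum is nonnegative, so replacing each integral by its positive part does not change it. -/
noncomputable def deGiorgiPerimeter {d : ℕ} (A : Set (EuclideanSpace ℝ (Fin d))) : ℝ≥0∞ :=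
  ⨆ (φ : EuclideanSpace ℝ (Fin d) → EuclideanSpace ℝ (Fin d)) (_ : IsPerimeterTestField φ),
    ENNReal.ofReal (∫ x in A, vectorFieldDiv φ x)

/-! Test `div φ` against a Lipschitz cutoff equal to 1 on `E_{tr}` and 0 off `E_r`. Its slope is at
most `1/((1-t)r)`, so integration by parts bounds `∫_{E_r} div φ` by `(1/((1-t)r) + K) |E_r \
E_{tr}|`, where `K` bounds `|div φ|`. Since `|E_s|/s^d` is nonincreasing, Bernoulli's inequality
gives the shell measure at most `d(1-t)|E_r|`. The factors `1-t` cancel in the main term, and the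
`K` term vanishes as `t → 1`. -/

open Metric Set Filter Topology Module in
/-- Shrinking the Voronoi cells of a finite set towards their centres gives
`t ^ n |F_r| ≤ |F_{t r}|`. -/
theorem ofReal_pow_mul_measure_thickening_finset_le {V : Type*} [NormedAddCommGroup V]
    [InnerProductSpace ℝ V] [FiniteDimensional ℝ V] [MeasurableSpace V] [BorelSpace V]
    (μ : Measure V) [μ.IsAddHaarMeasure] (F : Finset V) {r t : ℝ} (ht0 : 0 < t) (ht1 : t < 1) :
    ENNReal.ofReal (t ^ finrank ℝ V) * μ (thickening r (F : Set V)) ≤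
      μ (thickening (t * r) (F : Set V)) := by
  let W : V → Set V := fun c ↦ {x | ∀ b ∈ F, dist x c ≤ dist x b} ∩ ball c r
  have hWm : ∀ c, MeasurableSet (W c) := fun c ↦ by
    refine MeasurableSet.inter (IsClosed.measurableSet ?_) measurableSet_ball
    simp only [ofPred_forall]
    exact isClosed_biInter fun b _ ↦ isClosed_le (by fun_prop) (by fun_prop)
  let h : V → Set V := fun c ↦ AffineMap.homothety c t '' W c
  have hmeas : ∀ c, MeasurableSet (h c) := fun c ↦ by
    have hc : Topology.IsClosedEmbedding (AffineMap.homothety c t : V → V) := by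
      have := (((Homeomorph.subRight c).trans (Homeomorph.smulOfNeZero t ht0.ne')).trans
        (Homeomorph.addRight c)).isClosedEmbedding
      convert this using 1
      ext x
      simp [AffineMap.homothety_apply, Homeomorph.smulOfNeZero]
    exact hc.measurableEmbedding.measurableSet_image.2 (hWm c)
  have hcover : thickening r (F : Set V) ⊆ ⋃ c ∈ F, W c := by
    intro x hx
    obtain ⟨z, hz, hxz⟩ := mem_thickening_iff.1 hx
    obtain ⟨c, hc, hmin⟩ := F.exists_min_image (fun b ↦ dist x b) ⟨z, hz⟩
    exact mem_biUnion (show c ∈ (F : Set V) from hc) ⟨hmin, (hmin z hz).trans_lt hxz⟩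
  -- With `u = x - c`, `v = b - c`, the cell condition says `2⟨u,v⟩ ≤ |v|²`. After scaling `u` by `t
  -- < 1` this is strict, so the shrunken cells are disjoint.
  have hstrict : ∀ c, ∀ y ∈ h c, ∀ b ∈ F, b ≠ c → dist y c < dist y b := by
    rintro c _ ⟨x, ⟨hx, -⟩, rfl⟩ b hb hbc
    have h1 := hx b hb
    have hpos : 0 < ‖b - c‖ := norm_pos_iff.2 (sub_ne_zero.2 hbc)
    rw [dist_eq_norm, dist_eq_norm] at h1 ⊢
    have e1 : x - b = (x - c) - (b - c) := by abel
    have e2 : AffineMap.homothety c t x - c = t • (x - c) := by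
      simp [AffineMap.homothety_apply]
    have e3 : AffineMap.homothety c t x - b = t • (x - c) - (b - c) := by
      rw [← e2]; abel
    rw [e1] at h1
    rw [e2, e3]
    generalize x - c = u at *
    generalize b - c = v at *
    have h2 := pow_le_pow_left₀ (norm_nonneg _) h1 2
    refine lt_of_pow_lt_pow_left₀ 2 (norm_nonneg _) ?_
    rw [norm_sub_sq_real] at h2 ⊢
    rw [real_inner_smul_left]
    nlinarith [mul_pos hpos hpos]
  have hdisj : (F : Set V).PairwiseDisjoint h := by
    intro c hc b hb hcb
    refine Set.disjoint_left.2 fun y hyc hyb ↦ ?_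
    exact lt_asymm (hstrict c y hyc b hb hcb.symm) (hstrict b y hyb c hc hcb)
  have hsub : (⋃ c ∈ F, h c) ⊆ thickening (t * r) (F : Set V) := by
    refine iUnion₂_subset fun c hc ↦ ?_
    rintro _ ⟨x, ⟨-, hx⟩, rfl⟩
    refine mem_thickening_iff.2 ⟨c, hc, ?_⟩
    rw [dist_homothety_center, Real.norm_of_nonneg ht0.le, dist_comm]
    exact mul_lt_mul_of_pos_left hx ht0
  calc ENNReal.ofReal (t ^ finrank ℝ V) * μ (thickening r (F : Set V))
      ≤ ENNReal.ofReal (t ^ finrank ℝ V) * ∑ c ∈ F, μ (W c) := by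
        gcongr
        exact (measure_mono hcover).trans (measure_biUnion_finset_le F W)
    _ = ∑ c ∈ F, μ (h c) := by
        rw [Finset.mul_sum]
        refine Finset.sum_congr rfl fun c _ ↦ ?_
        rw [Measure.addHaar_image_homothety, abs_of_nonneg (by positivity)]
    _ = μ (⋃ c ∈ F, h c) := (measure_biUnion_finset hdisj fun c _ ↦ hmeas c).symm
    _ ≤ μ (thickening (t * r) (F : Set V)) := measure_mono hsub

open Metric Set Filter Topology Module in
/-- The function `s ↦ |E_s| / s ^ n` is nonincreasing. -/
theorem ofReal_pow_mul_measure_thickening_le {V : Type*} [NormedAddCommGroup V]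
    [InnerProductSpace ℝ V] [FiniteDimensional ℝ V] [MeasurableSpace V] [BorelSpace V]
    (μ : Measure V) [μ.IsAddHaarMeasure] (E : Set V) {r t : ℝ} (ht0 : 0 < t) (ht1 : t < 1) :
    ENNReal.ofReal (t ^ finrank ℝ V) * μ (thickening r E) ≤ μ (thickening (t * r) E) := by
  rw [isOpen_thickening.measure_eq_iSup_isCompact]
  simp only [ENNReal.mul_iSup]
  -- By inner regularity a compact `K` suffices, and finitely many balls centred in `E` cover it.
  refine iSup₂_le fun K hK ↦ iSup_le fun hKc ↦ ?_
  rw [thickening_eq_biUnion_ball] at hK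
  obtain ⟨F, hFE, hFfin, hKF⟩ :=
    hKc.elim_finite_subcover_image (fun c _ ↦ isOpen_ball (x := c) (ε := r)) hK
  lift F to Finset V using hFfin
  rw [← thickening_eq_biUnion_ball] at hKF
  calc ENNReal.ofReal (t ^ finrank ℝ V) * μ K
      ≤ ENNReal.ofReal (t ^ finrank ℝ V) * μ (thickening r (F : Set V)) := by gcongr
    _ ≤ μ (thickening (t * r) (F : Set V)) :=
        ofReal_pow_mul_measure_thickening_finset_le μ F ht0 ht1
    _ ≤ μ (thickening (t * r) E) := measure_mono (thickening_subset_of_subset _ hFE)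

theorem continuous_vectorFieldDiv {d : ℕ}
    {φ : EuclideanSpace ℝ (Fin d) → EuclideanSpace ℝ (Fin d)} (hφ : ContDiff ℝ 1 φ) :
    Continuous (vectorFieldDiv φ) := by
  have := hφ.continuous_fderiv (by simp)
  unfold vectorFieldDiv
  fun_prop

theorem HasCompactSupport.vectorFieldDiv {d : ℕ}
    {φ : EuclideanSpace ℝ (Fin d) → EuclideanSpace ℝ (Fin d)} (hφ : HasCompactSupport φ) :
    HasCompactSupport (vectorFieldDiv φ) :=
  (hφ.fderiv ℝ).comp_left
    (g := fun L : EuclideanSpace ℝ (Fin d) →L[ℝ] EuclideanSpace ℝ (Fin d) ↦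
      ∑ i, (L (EuclideanSpace.single i 1)) i) (by simp)

open scoped NNReal in
/-- Integration by parts of a Lipschitz function against the divergence of a test field. -/
theorem LipschitzWith.integral_mul_vectorFieldDiv {d : ℕ} {C : ℝ≥0}
    {f : EuclideanSpace ℝ (Fin d) → ℝ} (hf : LipschitzWith C f)
    {φ : EuclideanSpace ℝ (Fin d) → EuclideanSpace ℝ (Fin d)} (hφ : ContDiff ℝ 1 φ)
    (hφc : HasCompactSupport φ) :
    ∫ x, f x * vectorFieldDiv φ x = -∫ x, fderiv ℝ f x (φ x) := by
  have hdiff : Differentiable ℝ φ := hφ.differentiable (by simp)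
  have hc : ∀ i, HasCompactSupport fun x ↦ φ x i := fun i ↦
    hφc.comp_left (g := fun v : EuclideanSpace ℝ (Fin d) ↦ v i) (by simp)
  have hsm : ∀ i, ContDiff ℝ 1 fun x ↦ φ x i := fun i ↦ by fun_prop
  have hcomp : ∀ i x v, lineDeriv ℝ (fun x ↦ φ x i) x v = (fderiv ℝ φ x v) i := by
    intro i x v
    have h1 : HasFDerivAt (fun x ↦ φ x i)
        ((EuclideanSpace.proj i : EuclideanSpace ℝ (Fin d) →L[ℝ] ℝ).comp (fderiv ℝ φ x)) x :=
      (EuclideanSpace.proj i : EuclideanSpace ℝ (Fin d) →L[ℝ] ℝ).hasFDerivAt.comp x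
        (hdiff x).hasFDerivAt
    rw [h1.differentiableAt.lineDeriv_eq_fderiv, h1.fderiv]
    rfl
  have hparts : ∀ i : Fin d,
      ∫ x, f x * (fderiv ℝ φ x (EuclideanSpace.single i 1)) i =
        -∫ x, lineDeriv ℝ f x (EuclideanSpace.single i 1) * φ x i := by
    intro i
    obtain ⟨D, hD⟩ := ContDiff.lipschitzWith_of_hasCompactSupport (hc i) (hsm i) (by simp)
    rw [hf.integral_lineDeriv_mul_eq hD (hc i), ← integral_neg]
    refine integral_congr_ae (.of_forall fun x ↦ ?_)
    simp [hcomp, mul_comm]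
  have hint1 : ∀ i ∈ (Finset.univ : Finset (Fin d)),
      Integrable fun x ↦ f x * (fderiv ℝ φ x (EuclideanSpace.single i 1)) i := by
    intro i _
    have h1 := hφ.continuous_fderiv (by simp)
    have h2 := hf.continuous
    refine Continuous.integrable_of_hasCompactSupport (by fun_prop) (HasCompactSupport.mul_left ?_)
    exact (hφc.fderiv ℝ).comp_left
      (g := fun L : EuclideanSpace ℝ (Fin d) →L[ℝ] EuclideanSpace ℝ (Fin d) ↦
        (L (EuclideanSpace.single i 1)) i) (by simp)
  have hint2 : ∀ i ∈ (Finset.univ : Finset (Fin d)),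
      Integrable fun x ↦ lineDeriv ℝ f x (EuclideanSpace.single i 1) * φ x i := fun i _ ↦
    ((hsm i).continuous.integrable_of_hasCompactSupport (hc i)).smul_of_top_right
      (hf.memLp_lineDeriv _)
  simp only [vectorFieldDiv, Finset.mul_sum]
  rw [integral_finsetSum _ hint1, Finset.sum_congr rfl fun i _ ↦ hparts i,
    Finset.sum_neg_distrib, ← integral_finsetSum _ hint2]
  congr 1
  refine integral_congr_ae ?_
  filter_upwards [hf.ae_differentiableAt (μ := volume)] with x hx
  have hsum : φ x = ∑ i, φ x i • EuclideanSpace.single i (1 : ℝ) := by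
    simpa using ((EuclideanSpace.basisFun (Fin d) ℝ).sum_repr (φ x)).symm
  conv_rhs => rw [hsum]
  simp [hx.lineDeriv_eq_fderiv, mul_comm]

-- Split `1 = f + (1 - f)` with the cutoff `f`: the first part is integrated by parts, the second is
-- supported in the shell within `A`.
open Metric in
theorem setIntegral_vectorFieldDiv_thickening_le {d : ℕ} {E : Set (EuclideanSpace ℝ (Fin d))}
    (hE : E.Nonempty) {r : ℝ} (hr : 0 < r) (hfin : volume (thickening r E) ≠ ∞)
    {φ : EuclideanSpace ℝ (Fin d) → EuclideanSpace ℝ (Fin d)} (hφ : IsPerimeterTestField φ)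
    {K : ℝ} (hK : ∀ x, ‖vectorFieldDiv φ x‖ ≤ K) {t : ℝ} (ht1 : t < 1) :
    ∫ x in thickening r E, vectorFieldDiv φ x ≤
      (1 / ((1 - t) * r) + K) * volume.real (thickening r E \ thickening (t * r) E) := by
  obtain ⟨hφ1, hφc, hφn⟩ := hφ
  set A := thickening r E with hA
  set B := thickening (t * r) E with hB
  have hε : 0 < (1 - t) * r := mul_pos (sub_pos.2 ht1) hr
  have hAB : volume (A \ B) < ∞ := (measure_mono Set.sdiff_subset).trans_lt hfin.lt_top
  let C : NNReal := ⟨1 / ((1 - t) * r), by positivity⟩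
  let f : EuclideanSpace ℝ (Fin d) → ℝ := fun x ↦ max 0 (min 1 ((r - infDist x E) / ((1 - t) * r)))
  have hf : LipschitzWith C f := by
    refine LipschitzWith.const_max (LipschitzWith.const_min ?_ 1) 0
    refine LipschitzWith.of_dist_le_mul fun x y ↦ ?_
    have h1 := (lipschitz_infDist_pt E).dist_le_mul x y
    rw [NNReal.coe_one, one_mul] at h1
    rw [Real.dist_eq, ← sub_div, abs_div, abs_of_pos hε]
    change _ ≤ 1 / ((1 - t) * r) * dist x y
    rw [one_div, inv_mul_eq_div]
    gcongr
    rwa [sub_sub_sub_cancel_left, abs_sub_comm, ← Real.dist_eq]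
  have hf0 : ∀ x, 0 ≤ f x := fun x ↦ le_max_left _ _
  have hf1 : ∀ x, f x ≤ 1 := fun x ↦ max_le zero_le_one (min_le_left _ _)
  have hfA : ∀ x, x ∉ A → f x = 0 := by
    intro x hx
    rw [hA, mem_thickening_iff_infDist_lt hE, not_lt] at hx
    refine max_eq_left ((min_le_right _ _).trans ?_)
    exact div_nonpos_of_nonpos_of_nonneg (sub_nonpos.2 hx) hε.le
  have hfB : ∀ x, x ∈ B → f x = 1 := by
    intro x hx
    rw [hB, mem_thickening_iff_infDist_lt hE] at hx
    have : 1 ≤ (r - infDist x E) / ((1 - t) * r) := by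
      rw [one_le_div hε]
      linarith
    simp only [f]
    rw [min_eq_left this, max_eq_right zero_le_one]
  -- Off the shell `f` attains its global maximum or minimum, so `fderiv` vanishes even at points of
  -- nondifferentiability, where it is 0 by default. No boundary needs to be null.
  have hder : ∀ x, x ∉ A \ B → fderiv ℝ f x (φ x) = 0 := by
    intro x hx
    have : fderiv ℝ f x = 0 := by
      by_cases hxA : x ∈ A
      · have hxB : x ∈ B := by simpa [hxA] using hx
        refine IsLocalMax.fderiv_eq_zero (.of_forall fun y ↦ ?_)
        rw [hfB x hxB]
        exact hf1 y
      · refine IsLocalMin.fderiv_eq_zero (.of_forall fun y ↦ ?_)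
        rw [hfA x hxA]
        exact hf0 y
    simp [this]
  have hdiv : Integrable (vectorFieldDiv φ) :=
    (continuous_vectorFieldDiv hφ1).integrable_of_hasCompactSupport hφc.vectorFieldDiv
  have hfdiv : Integrable fun x ↦ f x * vectorFieldDiv φ x :=
    (hf.continuous.mul (continuous_vectorFieldDiv hφ1)).integrable_of_hasCompactSupport
      hφc.vectorFieldDiv.mul_left
  have hI1 : ∫ x in A, f x * vectorFieldDiv φ x ≤ 1 / ((1 - t) * r) * volume.real (A \ B) := by
    rw [setIntegral_eq_integral_of_forall_compl_eq_zero fun x hx ↦ by simp [hfA x hx],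
      hf.integral_mul_vectorFieldDiv hφ1 hφc,
      ← setIntegral_eq_integral_of_forall_compl_eq_zero hder]
    refine ((Real.le_norm_self _).trans_eq (norm_neg _)).trans (norm_setIntegral_le_of_norm_le_const hAB fun x _ ↦ ?_)
    calc ‖fderiv ℝ f x (φ x)‖ ≤ ‖fderiv ℝ f x‖ * ‖φ x‖ := (fderiv ℝ f x).le_opNorm _
      _ ≤ C * 1 := by
        gcongr
        · exact norm_fderiv_le_of_lipschitz ℝ hf
        · exact hφn x
      _ = 1 / ((1 - t) * r) := mul_one _
  have hI2 : ∫ x in A, (1 - f x) * vectorFieldDiv φ x ≤ K * volume.real (A \ B) := by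
    rw [setIntegral_eq_of_subset_of_forall_sdiff_eq_zero isOpen_thickening.measurableSet
      (Set.sdiff_subset : A \ B ⊆ A) fun x hx ↦ ?_]
    · refine (Real.le_norm_self _).trans (norm_setIntegral_le_of_norm_le_const hAB fun x _ ↦ ?_)
      rw [norm_mul, Real.norm_of_nonneg (sub_nonneg.2 (hf1 x))]
      exact (mul_le_of_le_one_left (norm_nonneg _) (by linarith [hf0 x])).trans (hK x)
    · have hxB : x ∈ B := by_contra fun h ↦ hx.2 ⟨hx.1, h⟩
      simp [hfB x hxB]
  calc ∫ x in A, vectorFieldDiv φ x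
      = ∫ x in A, (f x * vectorFieldDiv φ x + (1 - f x) * vectorFieldDiv φ x) := by
        congr 1 with x
        ring
    _ = (∫ x in A, f x * vectorFieldDiv φ x) + ∫ x in A, (1 - f x) * vectorFieldDiv φ x := by
        refine integral_add hfdiv.integrableOn (Integrable.integrableOn ?_)
        convert hdiv.sub hfdiv using 2 with x
        simp only [Pi.sub_apply]
        ring
    _ ≤ _ := by
        rw [add_mul]
        exact add_le_add hI1 hI2

open Metric in
theorem volume_real_thickening_diff_le {d : ℕ} (E : Set (EuclideanSpace ℝ (Fin d))) {r : ℝ}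
    (hr : 0 < r) (hfin : volume (thickening r E) ≠ ∞) {t : ℝ} (ht0 : 0 < t) (ht1 : t < 1) :
    volume.real (thickening r E \ thickening (t * r) E) ≤
      d * (1 - t) * volume.real (thickening r E) := by
  have hsub : thickening (t * r) E ⊆ thickening r E := thickening_mono (by nlinarith) E
  have h1 : t ^ d * volume.real (thickening r E) ≤ volume.real (thickening (t * r) E) := by
    have := ENNReal.toReal_mono (measure_ne_top_of_subset hsub hfin)
      (ofReal_pow_mul_measure_thickening_le volume E (r := r) ht0 ht1)
    rwa [ENNReal.toReal_mul, ENNReal.toReal_ofReal (by positivity), finrank_euclideanSpace_fin]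
      at this
  -- Bernoulli's inequality, the source of the constant `d`.
  have h2 : 1 + (d : ℝ) * (t - 1) ≤ t ^ d := by
    simpa using one_add_mul_le_pow (a := t - 1) (by linarith) d
  rw [measureReal_sdiff hsub isOpen_thickening.measurableSet]
  nlinarith [measureReal_nonneg (μ := volume) (s := thickening r E)]

/-- `Metric.thickening r E` is the open neighbourhood `{x | dist (x, E) < r}`, with the convention
`dist (x, ∅) = ∞`; perimeter and Lebesgue measure take values in `[0, ∞]`. -/
theorem propositionA1 (d : ℕ) (E : Set (EuclideanSpace ℝ (Fin d))) (r : ℝ) (hr : 0 < r) :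
    deGiorgiPerimeter (Metric.thickening r E) ≤
      ENNReal.ofReal ((d : ℝ) / r) * volume (Metric.thickening r E) := by
  refine iSup₂_le fun φ hφ ↦ ?_
  rcases E.eq_empty_or_nonempty with rfl | hE
  · simp
  -- For `d = 0` the factor `d / r` is 0, and `0 * ∞ = 0` would spoil the infinite-measure case
  -- below.
  rcases Nat.eq_zero_or_pos d with rfl | hd
  · simp [vectorFieldDiv]
  have hdr : 0 < (d : ℝ) / r := by positivity
  by_cases hfin : volume (Metric.thickening r E) = ∞
  · rw [hfin, ENNReal.mul_top (by simpa using hdr)]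
    exact le_top
  rw [← ofReal_measureReal hfin, ← ENNReal.ofReal_mul hdr.le]
  refine ENNReal.ofReal_le_ofReal ?_
  obtain ⟨K, hK⟩ := hφ.2.1.vectorFieldDiv.exists_bound_of_continuous
    (continuous_vectorFieldDiv hφ.1)
  have hK0 : 0 ≤ K := (norm_nonneg _).trans (hK 0)
  set m := volume.real (Metric.thickening r E)
  have hbound : ∀ t ∈ Set.Ioo (0 : ℝ) 1,
      ∫ x in Metric.thickening r E, vectorFieldDiv φ x ≤ (d / r + K * (d * (1 - t))) * m := by
    rintro t ⟨ht0, ht1⟩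
    have hε : 0 < 1 - t := sub_pos.2 ht1
    calc _ ≤ _ := setIntegral_vectorFieldDiv_thickening_le hE hr hfin hφ hK ht1
      _ ≤ (1 / ((1 - t) * r) + K) * (d * (1 - t) * m) := by
        gcongr
        exact volume_real_thickening_diff_le E hr hfin ht0 ht1
      _ = _ := by
        field_simp
  have hlim : Filter.Tendsto (fun t : ℝ ↦ ((d : ℝ) / r + K * (d * (1 - t))) * m)
      (nhdsWithin 1 (Set.Iio 1)) (nhds ((d / r + K * (d * (1 - 1))) * m)) :=
    (Continuous.tendsto (by fun_prop) 1).mono_left nhdsWithin_le_nhds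
  simp only [sub_self, mul_zero, add_zero] at hlim
  refine ge_of_tendsto hlim ?_
  filter_upwards [Ioo_mem_nhdsLT (zero_lt_one' ℝ)] with t ht using hbound t ht
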